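/- Let $X_1,X_2,\dots$ be i.i.d. $\{0,1\}$-valued random variables with $P(X_i=0)=p$ and $P(X_i=1)=q$ for all $i$, where $q>0$, and write $X_1^n=X_1\cdots X_n$. Notation. For words $w,x$ over $\{0,1\}$ let $\#(w;x)$ be the number of positions of $x$ at which $w$ occurs. For integers $0\le m_1<\dots<m_h$ and $x\in\{0,1\}^n$ let $s_i=\#(10^{m_i};1x)$, $s_{h+1}=0$, and $$D_{n,(m_1,\dots,m_h)}(x)=\sum_{i=1}^h i\,(s_i-s_{i+1})$$ (this is $0$ if $h=0$). For $m\ge1$ and $x\in\{0,1\}^n$ let $E_{n,m}(x)$ be the number of maximal runs of zeros in $x$ of length exactly $m$, $G_{n,m}(x)$ the number of maximal runs of zeros of length at least $m$, $L_n(x)$ the length of the longest run of zeros, and, for $0\le\mu\le m-1$, let $N_{n,m,\mu}(x)$ be the number of words $0^m$ counted when $x$ is scanned from left to right and a counted $0^m$ may share at most $\mu$ letters with the previously counted one. Let $T_m$ be the smallest $t$ such that $0^m$ occurs in $X_1\cdots X_t$ ($T_m=\infty$ if there is none). For nonnegative integers with $a_1+\dots+a_l\le n$ put $\binom{n}{a_1,\dots,a_l}=\frac{n!}{a_1!\cdots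 a_l!\,(n-\sum a_i)!}$. All summation variables below are nonnegative integers. Theorem. For all integers $n\ge 0$ and $t\ge0$: 1. for all $m_1<\dots<m_h$, $$P(D_{n,(m_1,\dots,m_h)}(X_1^n)=t)=\sum_{\substack{r,k_1,\dots,k_h:\\ \sum (m_i+1)k_i\le n+1,\ r\le\sum k_i\\ t=\sum ik_i-r}}(-1)^r\binom{n+1-\sum m_ik_i}{k_1,\dots,k_h}\binom{\sum k_i}{r}q^{\sum k_i-1}p^{\sum m_ik_i}$$ $$\qquad-\sum_{\substack{r,k_1,\dots,k_h:\\ \sum (m_i+1)k_i\le n,\ r\le\sum k_i\\ t=\sum ik_i-r}}(-1)^r\binom{n-\sum m_ik_i}{k_1,\dots,k_h}\binom{\sum k_i}{r}q^{\sum k_i-1}p^{1+\sum m_ik_i};$$ 2. for $m\ge1$ and $0\le\mu\le m-1$, $P(N_{n,m,\mu}(X_1^n)=t)=P(D_{n,(m_1,\dots,m_h)}(X_1^n)=t)$, where $h=\max\{0,\lfloor\frac{n-\mu}{m-\mu}\rfloor\}$ and $m_i=mi-\mu(i-1)$ for $1\le i\le h$; 3. for $m\ge1$, $P(G_{n,m}(X_1^n)=t)=P(D_{n,(m)}(X_1^n)=t)$,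 and this equals $$\sum_{t\le k\le\lfloor\frac{n+1}{m+1}\rfloor}(-1)^{k-t}\binom{n+1-mk}{t,k-t}q^{k-1}p^{km}-\sum_{t\le k\le\lfloor\frac{n}{m+1}\rfloor}(-1)^{k-t}\binom{n-mk}{t,k-t}q^{k-1}p^{km+1};$$ 4. for $m\ge1$, $P(T_m>n)=P(L_n(X_1^n)<m)=P(D_{n,(m)}(X_1^n)=0)$, and this equals $$\sum_{0\le k\le\lfloor\frac{n+1}{m+1}\rfloor}(-1)^k\binom{n+1-mk}{k}q^{k-1}p^{km}-\sum_{0\le k\le\lfloor\frac{n}{m+1}\rfloor}(-1)^k\binom{n-mk}{k}q^{k-1}p^{km+1};$$ 5. for $m\ge1$, $$P(E_{n,m}(X_1^n)=t)=\sum_{\substack{k_1,k_2:\ t\le k_1+k_2\\(m+1)k_1+(m+2)k_2\le n+1}}(-1)^{k_1-t}\binom{n+1-mk_1-(m+1)k_2}{k_1,k_2}\binom{k_1+k_2}{t}q^{k_1+k_2-1}p^{k_1m+k_2(m+1)}$$ $$\qquad-\sum_{\substack{k_1,k_2:\ t\le k_1+k_2\\(m+1)k_1+(m+2)k_2\le n}}(-1)^{k_1-t}\binom{n-mk_1-(m+1)k_2}{k_1,k_2}\binom{k_1+k_2}{t}q^{k_1+k_2-1}p^{k_1m+k_2(m+1)+1}.$$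 -/

import Mathlib

open MeasureTheory ProbabilityTheory
open scoped Nat

namespace ZeroRuns

/-- Binary words. -/
abbrev Word := List (Fin 2)

/-- The word `x₁ ⋯ xₙ` formed by the first `n` letters of an infinite binary sequence
(the letter `xᵢ` of the usual numbering is `x (i - 1)`). -/
def pre (n : ℕ) (x : ℕ → Fin 2) : Word := List.ofFn fun i : Fin n => x i

/-- The word `0ᵐ`. -/
def zeros (m : ℕ) : Word := List.replicate m 0

/-- The number of positions of `x` at which the word `w` occurs. -/
def occ (w x : Word) : ℕ :=
  ((Finset.range (x.length + 1 - w.length)).filter fun i => w <+: x.drop i).card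

/-- The vector `(s₁ - s₂, s₂ - s₃, …, s_h)`, where `sᵢ` is the number of occurrences
of the `i`-th word in `x`. -/
def occDiff {h : ℕ} (w : Fin h → Word) (x : Word) (i : Fin h) : ℤ :=
  (occ (w i) x : ℤ) - if hi : (i : ℕ) + 1 < h then (occ (w ⟨i + 1, hi⟩) x : ℤ) else 0

/-- The statistic `∑ i kᵢ` (with `i` running from `1` to `h`), where `(k₁, …, k_h)` is the vector
of differences for the words `1 0^{m₁}, …, 1 0^{m_h}` in the word `1x`. -/
def D {h : ℕ} (m : Fin h → ℕ) (x : Word) : ℤ :=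
  ∑ i : Fin h, ((i : ℤ) + 1) * occDiff (fun j => 1 :: zeros (m j)) (1 :: x) i

/-- Scanning from left to right, the next `c` positions are not allowed as starting points of a
counted `0ᵐ`; after a counted `0ᵐ` has started, the next allowed starting point is `m - μ`
positions later. -/
def scan (m μ : ℕ) : ℕ → Word → ℕ
  | _, [] => 0
  | c + 1, _ :: x => scan m μ c x
  | 0, a :: x => if zeros m <+: a :: x then scan m μ (m - μ - 1) x + 1 else scan m μ 0 x

/-- The `μ`-overlapping number of `0ᵐ`: the word is scanned from left to right, and a counted `0ᵐ`
may share at most `μ` letters with the previously counted one. -/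
def N (m μ : ℕ) (x : Word) : ℕ := scan m μ 0 x

/-- The letters of `x` at the positions `i, …, i + l - 1` (numbered from `0`) form a block of `l`
zeros that is not adjacent to a further zero of `x`. -/
def IsMaxRun (x : Word) (i l : ℕ) : Prop :=
  zeros l <+: x.drop i ∧ (∀ j < i, j + 1 = i → x[j]? ≠ some 0) ∧ x[i + l]? ≠ some 0

instance (x : Word) (i l : ℕ) : Decidable (IsMaxRun x i l) := by
  unfold IsMaxRun; infer_instance

/-- The number of maximal runs of zeros of length exactly `m`. -/
def E (m : ℕ) (x : Word) : ℕ :=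
  ((Finset.range x.length).filter fun i => IsMaxRun x i m).card

/-- The number of maximal runs of zeros of length at least `m`. -/
def G (m : ℕ) (x : Word) : ℕ :=
  ((Finset.range x.length).filter fun i => ∃ l ∈ Finset.Icc m x.length, IsMaxRun x i l).card

/-- The length of the longest run of zeros. -/
def L (x : Word) : ℕ := Nat.findGreatest (fun l => zeros l <:+: x) x.length

/-- The first time `t` such that `0ᵐ` appears in `x₁ ⋯ x_t` (and `⊤` if `0ᵐ` never appears). -/
noncomputable def T (m : ℕ) (x : ℕ → Fin 2) : ℕ∞ :=
  sInf ((fun t : ℕ => (t : ℕ∞)) '' {t : ℕ | zeros m <:+: pre t x})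

/-- The multinomial coefficient `a! / (k₁! ⋯ k_h! (a - ∑ kᵢ)!)`, used for `∑ kᵢ ≤ a`. -/
noncomputable def multinom (a : ℕ) {h : ℕ} (k : Fin h → ℕ) : ℝ :=
  (a ! : ℝ) / ((∏ i, ((k i)! : ℝ)) * ((a - ∑ i, k i)! : ℝ))

/-- The tuples `(k₁, …, k_h)` of nonnegative integers with `∑ (mᵢ + 1) kᵢ ≤ a`. -/
def tuples (a : ℕ) {h : ℕ} (m : Fin h → ℕ) : Finset (Fin h → ℕ) :=
  (Fintype.piFinset fun _ => Finset.range (a + 1)).filter fun k => ∑ i, (m i + 1) * k i ≤ a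

theorem mem_tuples {a h : ℕ} {m k : Fin h → ℕ} :
    k ∈ tuples a m ↔ ∑ i, (m i + 1) * k i ≤ a := by
  simp only [tuples, Finset.mem_filter, Fintype.mem_piFinset, Finset.mem_range,
    and_iff_right_iff_imp]
  intro hk i
  have h1 : (m i + 1) * k i ≤ ∑ i, (m i + 1) * k i :=
    Finset.single_le_sum (f := fun i => (m i + 1) * k i) (fun _ _ => Nat.zero_le _)
      (Finset.mem_univ i)
  nlinarith [Nat.zero_le (m i * k i)]

/-- The pairs `(k₁, k₂)` of nonnegative integers with `(m + 1) k₁ + (m + 2) k₂ ≤ a` and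
`t ≤ k₁ + k₂`. -/
def pairs (a m t : ℕ) : Finset (ℕ × ℕ) :=
  (Finset.range (a + 1) ×ˢ Finset.range (a + 1)).filter fun k =>
    (m + 1) * k.1 + (m + 2) * k.2 ≤ a ∧ t ≤ k.1 + k.2

theorem mem_pairs {a m t : ℕ} {k : ℕ × ℕ} :
    k ∈ pairs a m t ↔ (m + 1) * k.1 + (m + 2) * k.2 ≤ a ∧ t ≤ k.1 + k.2 := by
  simp only [pairs, Finset.mem_filter, Finset.mem_product, Finset.mem_range,
    and_iff_right_iff_imp]
  rintro ⟨h1, -⟩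
  constructor <;> nlinarith [Nat.zero_le (m * k.1), Nat.zero_le (m * k.2)]

end ZeroRuns

open ZeroRuns

/-! Put a 1 in front of x and cut 1x into gaps 1 0^l. Each counting statistic is a sum over these
gaps of a weight W l (`gapSum`): for D, after Abel summation, the number of thresholds m_i ≤ l; for
G the indicator of m ≤ l; for E that of l = m; for N the number of words 0^m counted in a run of
length l. Both T_m > n and L < m say that 0^m does not occur, i.e. that the sum for G vanishes.

Let u be an indeterminate and write u^(W l) = 1 + ∑_{m_i ≤ l} b_i. The ones form a renewal process:
with A(z) = ∑ p^l u^(W l) z^l, the sequence g_0 = 1, g_(n+1) = q E[u^stat] has generating function 1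
/ (1 - q z A(z)). Since (1 - p z) A = 1 + ∑ b_i p^(m_i) z^(m_i) and p + q = 1, this is (1 - p z) /
(1 - z - ∑ q p^(m_i) b_i z^(m_i + 1)) (`renewal_formula`). Expanding the inverse gives the
multinomial sums (`coeff_inverse_step`), the numerator makes the difference of two sums, and the
coefficient of u^t is the probability (`measureReal_gapSum`). Only the b_i vary: u^(i-1) (u - 1) for
D (`X_pow_card_eq`), and ±(u - 1) at the thresholds m, m + 1 for E (`X_pow_exact_eq`). -/

namespace ZeroRuns

/-! ### Power series: inverse of the step polynomial and the renewal equation. -/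

section Series

open PowerSeries

variable {R : Type*} [CommRing R]

/-- The number of arrangements of `k i` letters of each kind `i` among `a` places. -/
def arrangements (a : ℕ) {h : ℕ} (k : Fin h → ℕ) : ℕ :=
  a.choose (∑ i, k i) * Nat.multinomial Finset.univ k

theorem arrangements_eq_multinom {a h : ℕ} {k : Fin h → ℕ} (hk : ∑ i, k i ≤ a) :
    (arrangements a k : ℝ) = multinom a k := by
  have h1 := Nat.choose_mul_factorial_mul_factorial hk
  have h2 := Nat.multinomial_spec Finset.univ k
  have h3 : (∏ i, ((k i)! : ℝ)) ≠ 0 :=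
    Finset.prod_ne_zero_iff.2 fun i _ => by exact_mod_cast Nat.factorial_ne_zero _
  have h4 : ((a - ∑ i, k i)! : ℝ) ≠ 0 := by exact_mod_cast Nat.factorial_ne_zero _
  rw [multinom, eq_div_iff (mul_ne_zero h3 h4), ← h1, ← h2, arrangements]
  push_cast
  ring

/-- Choosing k i factors of each kind i among the N, each factor contributes degree 1 and one of
kind i contributes m i more, so the degree is N + ∑ m i * k i. -/
theorem coeff_pow_step {h : ℕ} (m : Fin h → ℕ) (c : Fin h → R) (a N : ℕ) (hN : N ≤ a) :
    coeff a ((X + ∑ i, C (c i) * X ^ (m i + 1) : R⟦X⟧) ^ N) =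
      ∑ k ∈ Fintype.piFinset fun _ : Fin h => Finset.range (a + 1),
        if ∑ i, k i ≤ N ∧ N + ∑ i, m i * k i = a then
          (arrangements N k : R) * ∏ i, c i ^ k i else 0 := by
  have hbox : ∀ j ≤ N, Finset.piAntidiag (Finset.univ : Finset (Fin h)) j =
      (Fintype.piFinset fun _ : Fin h => Finset.range (a + 1)).filter fun k => ∑ i, k i = j := by
    intro j hj
    ext k
    simp only [Finset.mem_piAntidiag, Finset.mem_filter, Fintype.mem_piFinset, Finset.mem_range,
      Finset.mem_univ, implies_true, and_true]
    refine ⟨fun hk => ⟨fun i => ?_, hk⟩, fun hk => hk.2⟩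
    have h1 : k i ≤ ∑ i, k i :=
      Finset.single_le_sum (f := k) (fun _ _ => Nat.zero_le _) (Finset.mem_univ i)
    have h2 : ∑ i, k i = j := hk
    omega
  rw [add_comm, add_pow, map_sum]
  have hterm : ∀ j ∈ Finset.range (N + 1),
      coeff a ((∑ i, C (c i) * X ^ (m i + 1) : R⟦X⟧) ^ j * X ^ (N - j) * (N.choose j : R⟦X⟧)) =
      ∑ k ∈ Fintype.piFinset fun _ : Fin h => Finset.range (a + 1),
        if ∑ i, k i = j then (if ∑ i, k i ≤ N ∧ N + ∑ i, m i * k i = a then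
          (arrangements N k : R) * ∏ i, c i ^ k i else 0) else 0 := by
    intro j hj
    rw [Finset.mem_range, Nat.lt_succ_iff] at hj
    rw [Finset.sum_pow_eq_sum_piAntidiag, hbox j hj, Finset.sum_mul, Finset.sum_mul, map_sum,
      Finset.sum_filter]
    refine Finset.sum_congr rfl fun k _ => ?_
    split_ifs with h1 h2
    · have : (Nat.multinomial Finset.univ k : R⟦X⟧) *
          (∏ i, (C (c i) * X ^ (m i + 1)) ^ k i) * X ^ (N - j) * (N.choose j : R⟦X⟧) =
          C ((arrangements N k : R) * ∏ i, c i ^ k i) * X ^ a := by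
        have e : ∑ i, (m i + 1) * k i + (N - j) = a := by
          simp only [add_mul, one_mul, Finset.sum_add_distrib]; omega
        simp only [mul_pow, Finset.prod_mul_distrib, ← pow_mul, Finset.prod_pow_eq_pow_sum]
        rw [← e, pow_add]
        simp only [arrangements, h1, map_mul, map_prod, map_pow, Nat.cast_mul, map_natCast]
        ring
      rw [this, coeff_C_mul, coeff_X_pow_self, mul_one]
    · have : (Nat.multinomial Finset.univ k : R⟦X⟧) *
          (∏ i, (C (c i) * X ^ (m i + 1)) ^ k i) * X ^ (N - j) * (N.choose j : R⟦X⟧) =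
          C ((arrangements N k : R) * ∏ i, c i ^ k i) * X ^ (N + ∑ i, m i * k i) := by
        have e : ∑ i, (m i + 1) * k i + (N - j) = N + ∑ i, m i * k i := by
          simp only [add_mul, one_mul, Finset.sum_add_distrib]; omega
        simp only [mul_pow, Finset.prod_mul_distrib, ← pow_mul, Finset.prod_pow_eq_pow_sum]
        rw [← e, pow_add]
        simp only [arrangements, h1, map_mul, map_prod, map_pow, Nat.cast_mul, map_natCast]
        ring
      rw [this, coeff_C_mul, coeff_X_pow, if_neg, mul_zero]
      intro h3
      exact h2 ⟨by omega, h3.symm⟩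
    · rfl
  rw [Finset.sum_congr rfl hterm, Finset.sum_comm]
  refine Finset.sum_congr rfl fun k _ => ?_
  rw [Finset.sum_ite_eq]
  split_ifs with h1 h2 h2
  · rfl
  · rfl
  · exact absurd (Finset.mem_range.2 (Nat.lt_succ_of_le h2.1)) h1
  · rfl

/-- The coefficient of `z ^ a` in `(1 - z - ∑ cᵢ z ^ (mᵢ + 1))⁻¹`. -/
def stepCoeff {h : ℕ} (m : Fin h → ℕ) (c : Fin h → R) (a : ℕ) : R :=
  ∑ k ∈ tuples a m, (arrangements (a - ∑ i, m i * k i) k : R) * ∏ i, c i ^ k i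

theorem coeff_inverse_step {h : ℕ} (m : Fin h → ℕ) (c : Fin h → R) (Q : R⟦X⟧)
    (hQ : Q * (1 - (X + ∑ i, C (c i) * X ^ (m i + 1))) = 1) (a : ℕ) :
    coeff a Q = stepCoeff m c a := by
  set f : R⟦X⟧ := X + ∑ i, C (c i) * X ^ (m i + 1) with hf
  obtain ⟨g, hg⟩ : X ∣ f := by
    refine dvd_add dvd_rfl (Finset.dvd_sum fun i _ => ?_)
    exact Dvd.dvd.mul_left (dvd_pow_self _ (Nat.succ_ne_zero _)) _
  -- Truncated geometric series: X divides f, so the remainder f ^ (a + 1) * Q does not reach degree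
  -- a.
  have h1 : Q = ∑ N ∈ Finset.range (a + 1), f ^ N + X ^ (a + 1) * (g ^ (a + 1) * Q) := by
    have h2 := geom_sum_mul f (a + 1)
    have h3 : X ^ (a + 1) * g ^ (a + 1) = f ^ (a + 1) := by rw [hg, mul_pow]
    rw [← mul_assoc, h3]
    linear_combination Q * h2 + (∑ N ∈ Finset.range (a + 1), f ^ N) * hQ
  rw [h1, map_add, coeff_X_pow_mul', if_neg (by omega), add_zero, map_sum]
  rw [Finset.sum_congr rfl fun N hN => coeff_pow_step m c a N
    (Nat.lt_succ_iff.1 (Finset.mem_range.1 hN)), Finset.sum_comm, stepCoeff, tuples,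
    Finset.sum_filter]
  refine Finset.sum_congr rfl fun k _ => ?_
  have e : ∑ i, (m i + 1) * k i = ∑ i, m i * k i + ∑ i, k i := by
    simp only [add_mul, one_mul, Finset.sum_add_distrib]
  rw [e]
  split_ifs with h2
  -- For fixed k the degree condition leaves a single power N.
  · rw [Finset.sum_eq_single (a - ∑ i, m i * k i), if_pos (by omega)]
    · intro N _ hN
      exact if_neg fun h3 => hN (by omega)
    · intro h3
      exact absurd (Finset.mem_range.2 (by omega)) h3
  · exact Finset.sum_eq_zero fun N _ => if_neg fun h3 => h2 (by omega)

/-- A geometric tail telescopes to one monomial; this is why gap weights are written with indicators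
of m i ≤ l. -/
theorem one_sub_mul_tail (p : R) (m : ℕ) :
    (1 - C p * X) * PowerSeries.mk (fun l => if m ≤ l then p ^ l else 0) = C (p ^ m) * X ^ m := by
  ext n
  rw [sub_mul, one_mul, map_sub, coeff_mk, mul_assoc, coeff_C_mul, coeff_C_mul, coeff_X_pow]
  cases n with
  | zero => cases m <;> simp
  | succ n =>
    rw [coeff_succ_X_mul, coeff_mk]
    rcases lt_trichotomy m (n + 1) with h | h | h
    · rw [if_pos (by omega), if_pos (by omega), if_neg (by omega)]; ring
    · rw [if_pos (by omega), if_neg (by omega), if_pos (by omega), h]; ring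
    · rw [if_neg (by omega), if_neg (by omega), if_neg (by omega)]; ring

/-- A renewal sequence, whose gaps have the weights `1 + ∑ bᵢ` (sum over all `i` such that
`mᵢ` is at most the length of the gap). -/
theorem renewal_formula {p q : R} (hpq : p + q = 1) {h : ℕ} (m : Fin h → ℕ) (b : Fin h → R)
    (V : ℕ → ℕ → R) (w : ℕ → R) (hw : ∀ l, w l = 1 + ∑ i, if m i ≤ l then b i else 0)
    (hV0 : ∀ l, V 0 l = w l) (hV : ∀ n l, V (n + 1) l = p * V n (l + 1) + q * w l * V n 0)
    (n : ℕ) :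
    q * V n 0 = stepCoeff m (fun i => q * p ^ m i * b i) (n + 1) -
      p * stepCoeff m (fun i => q * p ^ m i * b i) n := by
  set c : Fin h → R := fun i => q * p ^ m i * b i with hc
  -- Weight of what remains after a run of zeros: nothing (weight 1), or a 1 followed by an
  -- arbitrary word.
  set g : ℕ → R := fun n => Nat.casesOn n 1 fun n => q * V n 0 with hg
  -- Decomposition by the number j of leading zeros, which extend the open gap from l to l + j.
  have hVg : ∀ n l, V n l = ∑ j ∈ Finset.range (n + 1), p ^ j * w (l + j) * g (n - j) := by
    intro n
    induction n with
    | zero => intro l; simp [hV0, hg]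
    | succ n ih =>
      intro l
      rw [hV, ih (l + 1), Finset.sum_range_succ' _ (n + 1), Finset.mul_sum]
      congr 1
      · refine Finset.sum_congr rfl fun j _ => ?_
        rw [Nat.add_sub_add_right, add_right_comm l 1 j, add_assoc l j 1]
        ring
      · simp only [hg, pow_zero, add_zero, Nat.sub_zero, one_mul]; ring
  set W : R⟦X⟧ := PowerSeries.mk fun l => p ^ l * w l with hW
  have hconv : PowerSeries.mk (fun n => V n 0) = W * PowerSeries.mk g := by
    ext n
    rw [coeff_mk, coeff_mul, Finset.Nat.sum_antidiagonal_eq_sum_range_succ_mk, hVg]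
    simp [hW]
  have hgen : PowerSeries.mk g = 1 + C q * X * PowerSeries.mk (fun n => V n 0) := by
    ext n
    cases n with
    | zero => simp [hg]
    | succ n =>
      rw [map_add, mul_assoc, coeff_C_mul, coeff_succ_X_mul]
      simp [hg, coeff_one]
  have hW1 : (1 - C p * X) * W = 1 + ∑ i, C (b i) * (C (p ^ m i) * X ^ m i) := by
    have : W = PowerSeries.mk (fun l => if 0 ≤ l then p ^ l else 0) +
        ∑ i, C (b i) * PowerSeries.mk (fun l => if m i ≤ l then p ^ l else 0) := by
      ext l
      simp only [hW, coeff_mk, map_add, map_sum, coeff_C_mul, hw, Nat.zero_le, if_true, mul_add,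
        mul_one, Finset.mul_sum, mul_ite, mul_zero]
      congr 1
      exact Finset.sum_congr rfl fun i _ => by split_ifs <;> ring
    rw [this, mul_add, one_sub_mul_tail, Finset.mul_sum]
    congr 1
    · simp
    · exact Finset.sum_congr rfl fun i _ => by rw [← one_sub_mul_tail]; ring
  set f : R⟦X⟧ := X + ∑ i, C (c i) * X ^ (m i + 1) with hf
  have hfe : f = X + C q * X * ∑ i, C (b i) * (C (p ^ m i) * X ^ m i) := by
    rw [hf, Finset.mul_sum]
    congr 1
    refine Finset.sum_congr rfl fun i _ => ?_
    simp only [hc, map_mul]; ring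
  have hC : (C p : R⟦X⟧) + C q = 1 := by rw [← map_add, hpq, map_one]
  -- Multiply the renewal equation by 1 - p z; then p + q = 1 merges p z + q z into z.
  have hgf : PowerSeries.mk g * (1 - f) = 1 - C p * X := by
    have h1 : PowerSeries.mk g * (1 - C q * X * W) = 1 := by
      have := hgen
      rw [hconv] at this
      linear_combination this
    rw [hfe]
    linear_combination (1 - C p * X) * h1 + C q * X * PowerSeries.mk g * hW1
      + X * PowerSeries.mk g * hC
  have hunit : IsUnit (1 - f) := by
    rw [isUnit_iff_constantCoeff]
    simp [hf]
  obtain ⟨u, hu⟩ := hunit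
  have hQ : (↑u⁻¹ : R⟦X⟧) * (1 - f) = 1 := by rw [← hu, Units.inv_mul]
  have hco := coeff_inverse_step m c _ hQ
  have hfin : PowerSeries.mk g = (↑u⁻¹ : R⟦X⟧) * (1 - C p * X) := by
    rw [← hgf]
    linear_combination (-PowerSeries.mk g) * hQ
  have hcoef := congrArg (coeff (n + 1)) hfin
  rw [coeff_mk, mul_sub, mul_one, map_sub, hco,
    show (↑u⁻¹ : R⟦X⟧) * (C p * X) = C p * (X * ↑u⁻¹) by ring, coeff_C_mul, coeff_succ_X_mul,
    hco] at hcoef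
  exact hcoef

end Series

/-! ### Gap decomposition of words. -/

section Words

/-- The sum of the weights `W l` of the gaps `1 0 ^ l` of the word `1 0 ^ l x`. -/
def gapSum (W : ℕ → ℕ) : ℕ → Word → ℕ
  | l, [] => W l
  | l, a :: x => if a = 0 then gapSum W (l + 1) x else W l + gapSum W 0 x

theorem gapSum_zeros_append (W : ℕ → ℕ) (k l : ℕ) (x : Word) :
    gapSum W l (zeros k ++ x) = gapSum W (l + k) x := by
  induction k generalizing l with
  | zero => rfl
  | succ k ih =>
    rw [zeros, List.replicate_succ, List.cons_append, gapSum, if_pos rfl]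
    exact (ih (l + 1)).trans (by rw [add_right_comm, add_assoc])

theorem gapSum_congr {W W' : ℕ → ℕ} {n : ℕ} (h : ∀ l ≤ n, W l = W' l) (x : Word) (l : ℕ)
    (hl : l + x.length ≤ n) : gapSum W l x = gapSum W' l x := by
  induction x generalizing l with
  | nil => exact h l hl
  | cons a x ih =>
    rw [List.length_cons] at hl
    rw [gapSum, gapSum, ih (l + 1) (by omega), ih 0 (by omega), h l (by omega)]

theorem sum_gapSum {ι : Type*} (s : Finset ι) (W : ι → ℕ → ℕ) (x : Word) (l : ℕ) :
    ∑ i ∈ s, gapSum (W i) l x = gapSum (fun l => ∑ i ∈ s, W i l) l x := by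
  induction x generalizing l with
  | nil => rfl
  | cons a x ih =>
    simp only [gapSum]
    split_ifs
    · exact ih _
    · rw [Finset.sum_add_distrib, ih]

/-- A word is 0^k or 0^k 1 x; the claim is generalized over k because leading zeros are absorbed one
at a time. -/
theorem word_induction {C : Word → Prop} (h0 : ∀ k, C (zeros k))
    (h1 : ∀ k x, C x → C (zeros k ++ 1 :: x)) (x : Word) : C x := by
  suffices h : ∀ k, C (zeros k ++ x) from h 0
  induction x with
  | nil => intro k; rw [List.append_nil]; exact h0 k
  | cons a x ih =>
    intro k
    obtain rfl | rfl : a = 0 ∨ a = 1 := by revert a; decide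
    · have : zeros k ++ 0 :: x = zeros (k + 1) ++ x := by
        rw [zeros, zeros, List.replicate_succ', List.append_assoc, List.singleton_append]
      rw [this]
      exact ih _
    · exact h1 k x (ih 0)

/-- The criterion applied to every count: additivity across the first 1 determines it from its
values on blocks of zeros. -/
theorem eq_gapSum {f : Word → ℕ} {W : ℕ → ℕ} (h0 : ∀ k, f (zeros k) = W k)
    (h1 : ∀ k x, f (zeros k ++ 1 :: x) = W k + f x) (x : Word) : f x = gapSum W 0 x := by
  induction x using word_induction with
  | h0 k =>
    have := gapSum_zeros_append W k 0 []
    rw [List.append_nil, zero_add] at this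
    rw [h0, this, gapSum]
  | h1 k x ih => rw [h1, gapSum_zeros_append, zero_add, gapSum, if_neg (by decide), ih]

theorem zeros_prefix_iff {m k : ℕ} {y : Word} (hy : y.head? ≠ some 0) :
    zeros m <+: zeros k ++ y ↔ m ≤ k := by
  induction m generalizing k with
  | zero => simp [zeros]
  | succ m ih =>
    cases k with
    | zero =>
      cases y with
      | nil => simp [zeros]
      | cons a y =>
        have ha : ¬ 0 = a := fun h => hy (by simp [h])
        simp [zeros, List.replicate_succ, ha]
    | succ k =>
      have := @ih k
      simp only [zeros, List.replicate_succ, List.cons_append, List.cons_prefix_cons,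
        true_and, Nat.add_le_add_iff_right] at this ⊢
      exact this

theorem head?_one_cons_ne (x : Word) : (1 :: x : Word).head? ≠ some 0 := by simp

theorem head?_nil_ne : ([] : Word).head? ≠ some 0 := by simp

/-! ### Occurrences of 1 0^m and the statistic D. -/

section Occurrences

/-- The added positions leave too few letters for w. The longer range does not depend on w, which
gives a recursion on letters. -/
theorem occ_eq_sum {w : Word} (hw : w ≠ []) (x : Word) :
    occ w x = ∑ i ∈ Finset.range x.length, if w <+: x.drop i then 1 else 0 := by
  rw [← Finset.card_filter, occ]
  congr 1
  ext i
  have hl := List.length_pos_iff.2 hw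
  simp only [Finset.mem_filter, Finset.mem_range, and_congr_left_iff]
  intro h
  have := h.length_le
  rw [List.length_drop] at this
  omega

theorem occ_nil {w : Word} (hw : w ≠ []) : occ w [] = 0 := by simp [occ_eq_sum hw]

theorem occ_cons {w : Word} (hw : w ≠ []) (a : Fin 2) (x : Word) :
    occ w (a :: x) = (if w <+: a :: x then 1 else 0) + occ w x := by
  rw [occ_eq_sum hw, occ_eq_sum hw, List.length_cons, Finset.sum_range_succ', add_comm]
  rfl

theorem occ_zeros_append (w x : Word) (k : ℕ) : occ (1 :: w) (zeros k ++ x) = occ (1 :: w) x := by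
  induction k with
  | zero => rfl
  | succ k ih =>
    rw [zeros, List.replicate_succ, List.cons_append, occ_cons (List.cons_ne_nil _ _), if_neg,
      zero_add]
    · exact ih
    · simp

/-- An occurrence starts at a 1 whose gap has length at least m; the 1 put in front makes the
initial run a gap too. -/
theorem occ_one_zeros (m : ℕ) (x : Word) :
    occ (1 :: zeros m) (1 :: x) = gapSum (fun l => if m ≤ l then 1 else 0) 0 x := by
  refine eq_gapSum (f := fun x => occ (1 :: zeros m) (1 :: x)) (fun k => ?_) (fun k x => ?_) x
  · have h1 := occ_zeros_append (zeros m) [] k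
    have h2 := zeros_prefix_iff (m := m) (k := k) head?_nil_ne
    rw [List.append_nil] at h1 h2
    simp only [occ_cons (List.cons_ne_nil _ _), h1, occ_nil (List.cons_ne_nil _ _),
      List.cons_prefix_cons, h2, true_and, add_zero]
  · have h2 := zeros_prefix_iff (m := m) (k := k) (head?_one_cons_ne x)
    rw [occ_cons (List.cons_ne_nil _ _), occ_zeros_append]
    simp only [List.cons_prefix_cons, h2, true_and]

/-- Abel summation; it reduces D to the plain sum of the occurrence counts. -/
theorem sum_mul_sub_succ (s : ℕ → ℤ) (n : ℕ) :
    ∑ i ∈ Finset.range n, ((i : ℤ) + 1) * (s i - s (i + 1)) =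
      ∑ i ∈ Finset.range n, s i - n * s n := by
  induction n with
  | zero => simp
  | succ n ih =>
    rw [Finset.sum_range_succ, Finset.sum_range_succ, ih]
    push_cast
    ring

theorem D_eq_gapSum {h : ℕ} (m : Fin h → ℕ) (x : Word) :
    D m x = (gapSum (fun l => ∑ i, if m i ≤ l then 1 else 0) 0 x : ℕ) := by
  rw [← sum_gapSum]
  simp only [← occ_one_zeros]
  -- Extension by 0 encodes s_{h+1} = 0, so the boundary term disappears.
  set s : ℕ → ℤ := fun j =>
    if hj : j < h then (occ (1 :: zeros (m ⟨j, hj⟩)) (1 :: x) : ℤ) else 0 with hs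
  have h1 : D m x = ∑ i ∈ Finset.range h, ((i : ℤ) + 1) * (s i - s (i + 1)) := by
    rw [D, ← Fin.sum_univ_eq_sum_range (fun i => ((i : ℤ) + 1) * (s i - s (i + 1)))]
    refine Finset.sum_congr rfl fun i _ => ?_
    simp only [occDiff, hs, i.2, dif_pos, Fin.eta]
  rw [h1, sum_mul_sub_succ, ← Fin.sum_univ_eq_sum_range]
  simp [hs]

end Occurrences

/-! ### Maximal runs of zeros. -/

section Runs

theorem zeros_append_getElem? {m k : ℕ} {y : Word} (hmk : m ≤ k) (hy : y.head? ≠ some 0) :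
    (zeros k ++ y)[m]? ≠ some 0 ↔ m = k := by
  rcases hmk.lt_or_eq with h | rfl
  · rw [List.getElem?_append_left (by simpa [zeros] using h)]
    simp [zeros, h, h.ne]
  · rw [List.getElem?_append_right (by simp [zeros])]
    simpa [zeros, List.head?_eq_getElem?] using hy

theorem isMaxRun_zero_iff {k l : ℕ} {y : Word} (hy : y.head? ≠ some 0) :
    IsMaxRun (zeros k ++ y) 0 l ↔ l = k := by
  rw [IsMaxRun, List.drop_zero, zeros_prefix_iff hy, zero_add]
  constructor
  · rintro ⟨h1, -, h2⟩
    exact (zeros_append_getElem? h1 hy).1 h2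
  · rintro rfl
    exact ⟨le_rfl, by simp, (zeros_append_getElem? le_rfl hy).2 rfl⟩

theorem not_isMaxRun_succ {k i l : ℕ} (y : Word) (hi : i < k) :
    ¬ IsMaxRun (zeros k ++ y) (i + 1) l := by
  intro h
  refine h.2.1 i (Nat.lt_succ_self i) rfl ?_
  rw [List.getElem?_append_left (by simpa [zeros] using hi)]
  simp [zeros, hi]

theorem not_isMaxRun_one {k l : ℕ} (y : Word) (hl : 1 ≤ l) :
    ¬ IsMaxRun (zeros k ++ 1 :: y) k l := by
  intro h
  have h1 := h.1
  rw [List.drop_left' (by simp [zeros])] at h1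
  have := (zeros_prefix_iff (k := 0) (head?_one_cons_ne y)).1 h1
  omega

/-- Maximality concerns only neighbouring letters, and a 1 on the left acts like the border of the
word. -/
theorem isMaxRun_shift {k j l : ℕ} (y : Word) :
    IsMaxRun (zeros k ++ 1 :: y) (k + 1 + j) l ↔ IsMaxRun y j l := by
  have hdrop : (zeros k ++ 1 :: y).drop (k + 1 + j) = y.drop j := by
    rw [← List.drop_drop, ← List.drop_drop, List.drop_left' (by simp [zeros])]
    rfl
  have hget : ∀ i, (zeros k ++ 1 :: y)[k + 1 + i]? = y[i]? := by
    intro i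
    rw [List.getElem?_append_right (by simp [zeros]; omega)]
    rw [show k + 1 + i - (zeros k).length = i + 1 by simp [zeros]; omega]
    rfl
  have hone : (zeros k ++ 1 :: y)[k]? ≠ some 0 :=
    (zeros_append_getElem? le_rfl (head?_one_cons_ne y)).2 rfl
  rw [IsMaxRun, IsMaxRun, hdrop, add_assoc (k + 1) j l, hget]
  refine and_congr_right fun _ => and_congr_left fun _ => ⟨fun h i hi hij => ?_,
    fun h i hi hij => ?_⟩
  · have := h (k + 1 + i) (by omega) (by omega)
    rwa [hget] at this
  · rcases Nat.eq_zero_or_pos j with rfl | hj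
    · obtain rfl : i = k := by omega
      exact hone
    · obtain rfl : i = k + 1 + (j - 1) := by omega
      rw [hget]
      exact h _ (by omega) (by omega)

open Classical in
/-- The number of maximal runs of zeros whose length is positive and satisfies `p`. -/
noncomputable def runCount (p : ℕ → Prop) (x : Word) : ℕ :=
  ∑ i ∈ Finset.range x.length, if ∃ l, 1 ≤ l ∧ p l ∧ IsMaxRun x i l then 1 else 0

open Classical in
-- Within the block only position 0 can start a maximal run, and its length is then forced to be k.
theorem sum_isMaxRun_zeros (p : ℕ → Prop) [DecidablePred p] (k : ℕ) {y : Word} (hy : y.head? ≠ some 0) :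
    (∑ i ∈ Finset.range k, if ∃ l, 1 ≤ l ∧ p l ∧ IsMaxRun (zeros k ++ y) i l then 1 else 0) =
      if 1 ≤ k ∧ p k then 1 else 0 := by
  cases k with
  | zero => simp
  | succ k =>
    rw [Finset.sum_range_succ', Finset.sum_eq_zero, zero_add]
    · simp only [isMaxRun_zero_iff hy]
      refine if_congr ⟨?_, fun h => ⟨_, h.1, h.2, rfl⟩⟩ rfl rfl
      rintro ⟨l, h1, h2, rfl⟩
      exact ⟨h1, h2⟩
    · intro i hi
      refine if_neg ?_
      rintro ⟨l, -, -, hl⟩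
      exact not_isMaxRun_succ _ ((Finset.mem_range.1 hi).trans (Nat.lt_succ_self k)) hl

open Classical in
theorem runCount_eq_gapSum (p : ℕ → Prop) [DecidablePred p] (x : Word) :
    runCount p x = gapSum (fun l => if 1 ≤ l ∧ p l then 1 else 0) 0 x := by
  refine eq_gapSum (fun k => ?_) (fun k y => ?_) x
  · have := sum_isMaxRun_zeros p k head?_nil_ne
    rw [List.append_nil] at this
    rw [← this, runCount, zeros, List.length_replicate]
  · have hk : ¬ ∃ l, 1 ≤ l ∧ p l ∧ IsMaxRun (zeros k ++ 1 :: y) k l := by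
      rintro ⟨l, h1, -, h2⟩
      exact not_isMaxRun_one _ h1 h2
    rw [runCount, show (zeros k ++ 1 :: y).length = k + 1 + y.length by simp [zeros]; omega,
      Finset.sum_range_add, Finset.sum_range_succ,
      sum_isMaxRun_zeros p k (head?_one_cons_ne y), if_neg hk, add_zero, runCount]
    simp only [isMaxRun_shift]

theorem E_eq_gapSum {m : ℕ} (hm : 1 ≤ m) (x : Word) :
    E m x = gapSum (fun l => if l = m then 1 else 0) 0 x := by
  have h : E m x = runCount (· = m) x := by
    classical
    rw [E, runCount, Finset.card_filter]
    refine Finset.sum_congr rfl fun i _ => if_congr ⟨fun h => ⟨m, hm, rfl, h⟩, ?_⟩ rfl rfl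
    rintro ⟨l, -, rfl, h⟩
    exact h
  rw [h, runCount_eq_gapSum]
  congr 1
  funext l
  exact if_congr ⟨fun h => h.2, fun h => ⟨h ▸ hm, h⟩⟩ rfl rfl

theorem G_eq_gapSum {m : ℕ} (hm : 1 ≤ m) (x : Word) :
    G m x = gapSum (fun l => if m ≤ l then 1 else 0) 0 x := by
  have h : G m x = runCount (m ≤ ·) x := by
    classical
    rw [G, runCount, Finset.card_filter]
    refine Finset.sum_congr rfl fun i _ => if_congr ⟨?_, ?_⟩ rfl rfl
    · rintro ⟨l, hl, h⟩
      have := Finset.mem_Icc.1 hl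
      exact ⟨l, by omega, this.1, h⟩
    · rintro ⟨l, -, h1, h2⟩
      refine ⟨l, Finset.mem_Icc.2 ⟨h1, ?_⟩, h2⟩
      have := h2.1.length_le
      rw [zeros, List.length_replicate, List.length_drop] at this
      omega
  rw [h, runCount_eq_gapSum]
  congr 1
  funext l
  exact if_congr ⟨fun h => h.2, fun h => ⟨hm.trans h, h⟩⟩ rfl rfl

end Runs

/-! ### Overlapping counts. -/

section Scan

/-- The number of words `0 ^ m` counted in a run of length `l`. -/
def overlapCount (m μ l : ℕ) : ℕ := if m ≤ l then (l - m) / (m - μ) + 1 else 0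

theorem scan_skip (m μ c j : ℕ) (y : Word) :
    scan m μ c (zeros (c + j) ++ y) = scan m μ 0 (zeros j ++ y) := by
  induction c with
  | zero => rw [zero_add]
  | succ c ih =>
    rw [add_right_comm, zeros, List.replicate_succ, List.cons_append, scan]
    exact ih

/-- One counted word moves the next allowed start by m - μ, as if the run were shortened by that
amount. -/
theorem overlapCount_step {m μ k : ℕ} (hμ : μ < m) (hk : m ≤ k) :
    overlapCount m μ k = overlapCount m μ (k - (m - μ)) + 1 := by
  rw [overlapCount, if_pos hk, overlapCount]
  split_ifs with h
  · have : k - m = (k - (m - μ) - m) + (m - μ) := by omega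
    rw [this, Nat.add_div_right _ (by omega)]
  · rw [Nat.div_eq_of_lt (by omega)]

theorem scan_zeros_append {m μ : ℕ} (hμ : μ < m) (k : ℕ) {y : Word} (hy : y.head? ≠ some 0) :
    scan m μ 0 (zeros k ++ y) = overlapCount m μ k + scan m μ 0 y := by
  induction k using Nat.strong_induction_on with
  | _ k ih =>
    cases k with
    | zero => rw [overlapCount, if_neg (by omega), zero_add]; rfl
    | succ k =>
      have hp := zeros_prefix_iff (m := m) (k := k + 1) hy
      have hc : zeros (k + 1) ++ y = 0 :: (zeros k ++ y) := rfl
      rw [hc] at hp ⊢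
      rw [scan]
      by_cases h : m ≤ k + 1
      · rw [if_pos (hp.2 h), overlapCount_step hμ h]
        obtain ⟨j, hj⟩ : ∃ j, k = m - μ - 1 + j := ⟨k - (m - μ - 1), by omega⟩
        rw [show k + 1 - (m - μ) = j by omega, hj, scan_skip, ih j (by omega)]
        ring
      · rw [if_neg (fun h' => h (hp.1 h')), ih k (Nat.lt_succ_self k), overlapCount, overlapCount,
          if_neg h, if_neg (by omega)]

theorem N_eq_gapSum {m μ : ℕ} (hμ : μ < m) (x : Word) :
    N m μ x = gapSum (overlapCount m μ) 0 x := by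
  refine eq_gapSum (fun k => ?_) (fun k y => ?_) x
  · have := scan_zeros_append hμ k head?_nil_ne
    rwa [List.append_nil] at this
  · rw [N, scan_zeros_append hμ k (head?_one_cons_ne y), scan, if_neg, N]
    intro h
    have := (zeros_prefix_iff (k := 0) (head?_one_cons_ne y)).1 h
    omega

/-- The thresholds form the progression m + i (m - μ); those up to n suffice, since no gap is longer
than n. -/
theorem sum_overlap {m μ n l : ℕ} (hμ : μ < m) (hl : l ≤ n) :
    (∑ i : Fin ((n - μ) / (m - μ)), if m * ((i : ℕ) + 1) - μ * (i : ℕ) ≤ l then 1 else 0) =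
      overlapCount m μ l := by
  rw [Fin.sum_univ_eq_sum_range (fun i => if m * (i + 1) - μ * i ≤ l then 1 else 0),
    ← Finset.card_filter]
  have he : ∀ i, m * (i + 1) - μ * i = m + i * (m - μ) := by
    intro i
    obtain ⟨d, rfl⟩ := Nat.exists_eq_add_of_lt hμ
    rw [show μ + d + 1 - μ = d + 1 by omega]
    rw [Nat.sub_eq_iff_eq_add (by nlinarith)]
    ring
  have hd : 0 < m - μ := by omega
  simp only [he]
  rw [overlapCount]
  split_ifs with h
  · have h1 : (Finset.range ((n - μ) / (m - μ))).filter (fun i => m + i * (m - μ) ≤ l) =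
        Finset.range ((l - m) / (m - μ) + 1) := by
      ext i
      have h2 : (n - μ) / (m - μ) = (n - m) / (m - μ) + 1 := by
        rw [← Nat.add_div_right _ hd]
        congr 1
        omega
      have h3 : (l - m) / (m - μ) ≤ (n - m) / (m - μ) := Nat.div_le_div_right (by omega)
      have h4 := Nat.le_div_iff_mul_le hd (x := i) (y := l - m)
      rw [Finset.mem_filter, Finset.mem_range, Finset.mem_range, h2, Nat.lt_succ_iff,
        Nat.lt_succ_iff, h4]
      constructor
      · rintro ⟨-, h5⟩
        omega
      · intro h5
        exact ⟨(h4.2 h5).trans h3, by omega⟩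
    rw [h1, Finset.card_range]
  · rw [Finset.card_eq_zero, Finset.filter_eq_empty_iff]
    intro i _
    have := Nat.zero_le (i * (m - μ))
    omega

theorem N_eq_D {m μ : ℕ} (hμ : μ < m) (x : Word) :
    (N m μ x : ℤ) = D (fun i : Fin ((x.length - μ) / (m - μ)) =>
      m * ((i : ℕ) + 1) - μ * (i : ℕ)) x := by
  rw [D_eq_gapSum, N_eq_gapSum hμ]
  congr 1
  exact gapSum_congr (n := x.length) (fun l hl => (sum_overlap hμ hl).symm) x 0 (by omega)

end Scan

/-! ### Longest run and waiting time. -/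

section LongestRun

theorem zeros_infix_append_iff {m : ℕ} (hm : 1 ≤ m) (k : ℕ) {y : Word} (hy : y.head? ≠ some 0) :
    zeros m <:+: zeros k ++ y ↔ m ≤ k ∨ zeros m <:+: y := by
  induction k with
  | zero =>
    rw [or_iff_right (by omega)]
    rfl
  | succ k ih =>
    have hp := zeros_prefix_iff (m := m) (k := k + 1) hy
    have hc : zeros (k + 1) ++ y = 0 :: (zeros k ++ y) := rfl
    rw [hc] at hp ⊢
    rw [List.infix_cons_iff, hp, ih, ← or_assoc]
    exact or_congr_left ⟨fun h => by omega, fun h => Or.inl h⟩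

theorem zeros_infix_iff {m : ℕ} (hm : 1 ≤ m) (x : Word) :
    zeros m <:+: x ↔ gapSum (fun l => if m ≤ l then 1 else 0) 0 x ≠ 0 := by
  induction x using word_induction with
  | h0 k =>
    have h1 := zeros_infix_append_iff hm k head?_nil_ne
    have h2 := gapSum_zeros_append (fun l => if m ≤ l then 1 else 0) k 0 []
    rw [List.append_nil] at h1 h2
    rw [h1, h2, gapSum, or_iff_left, zero_add]
    · simp
    · rw [List.infix_nil, zeros, List.replicate_eq_nil_iff]
      omega
  | h1 k x ih =>
    rw [zeros_infix_append_iff hm k (head?_one_cons_ne x), gapSum_zeros_append, gapSum,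
      if_neg (by decide), List.infix_cons_iff, ih, or_iff_right (a := zeros m <+: 1 :: x), zero_add]
    · split_ifs with h <;> simp [h]
    · intro h
      have := (zeros_prefix_iff (k := 0) (head?_one_cons_ne x)).1 h
      omega

theorem L_lt_iff {m : ℕ} (x : Word) : L x < m ↔ ¬ zeros m <:+: x := by
  rw [← not_le, not_iff_not]
  constructor
  · intro h
    have h1 : zeros (L x) <:+: x :=
      Nat.findGreatest_spec (P := fun l => zeros l <:+: x) (Nat.zero_le _) (List.nil_infix)
    refine List.IsInfix.trans (List.IsPrefix.isInfix ?_) h1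
    have := (zeros_prefix_iff (m := m) (k := L x) head?_nil_ne).2 h
    rwa [List.append_nil] at this
  · intro h
    refine Nat.le_findGreatest ?_ h
    simpa [zeros] using h.length_le

theorem pre_prefix_pre {s n : ℕ} (h : s ≤ n) (x : ℕ → Fin 2) : pre s x <+: pre n x := by
  rw [List.prefix_iff_eq_take]
  refine List.ext_getElem (by simp [pre, h]) fun i _ _ => by simp [pre]

theorem lt_T_iff (m n : ℕ) (x : ℕ → Fin 2) : (n : ℕ∞) < T m x ↔ ¬ zeros m <:+: pre n x := by
  constructor
  · intro h h1
    have h2 : T m x ≤ n := sInf_le ⟨n, h1, rfl⟩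
    exact not_lt_of_ge h2 h
  · intro h
    by_contra h1
    rw [not_lt] at h1
    have hne : ((fun t : ℕ => (t : ℕ∞)) '' {t : ℕ | zeros m <:+: pre t x}).Nonempty := by
      by_contra h2
      rw [Set.not_nonempty_iff_eq_empty] at h2
      rw [T, h2, sInf_empty] at h1
      exact absurd h1 (by simp)
    -- A nonempty set in `ℕ∞` attains its infimum, so 0^m already occurs in a prefix of length s ≤
    -- n.
    obtain ⟨s, hs, hsT⟩ := csInf_mem hne
    have hsn : s ≤ n := by
      have h3 : ((s : ℕ) : ℕ∞) ≤ n := hsT.trans_le h1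
      exact_mod_cast h3
    exact h (List.IsInfix.trans hs (pre_prefix_pre hsn x).isInfix)

end LongestRun

end Words

/-! ### From independent letters to generating functions. -/

section Law

/-- The sum of `f x` over the words `x` of length `n`, weighted with `p` for each `0` and `q` for
each `1`. -/
def wordSum {R : Type*} [CommRing R] (p q : R) : ℕ → (Word → R) → R
  | 0, f => f []
  | n + 1, f => p * wordSum p q n (fun x => f (0 :: x)) + q * wordSum p q n (fun x => f (1 :: x))

theorem sum_prod_eq_wordSum {R : Type*} [CommRing R] (p q : R) (n : ℕ) (f : Word → R) :
    ∑ v : Fin n → Fin 2, (∏ i, if v i = 0 then p else q) * f (List.ofFn v) = wordSum p q n f := by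
  induction n generalizing f with
  | zero => simp [wordSum]
  | succ n ih =>
    rw [← (Fin.consEquiv fun _ => Fin 2).sum_comp, Fintype.sum_prod_type, Fin.sum_univ_two, wordSum,
      ← ih, ← ih, Finset.mul_sum, Finset.mul_sum]
    congr 1 <;>
    · refine Finset.sum_congr rfl fun v _ => ?_
      simp [Fin.consEquiv, Fin.prod_univ_succ, List.ofFn_succ, mul_assoc]

theorem wordSum_mul_left {R : Type*} [CommRing R] (p q c : R) (n : ℕ) (f : Word → R) :
    wordSum p q n (fun x => c * f x) = c * wordSum p q n f := by
  induction n generalizing f with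
  | zero => rfl
  | succ n ih => simp only [wordSum, ih]; ring

/-- Taking coefficients commutes with the weighted sum, so probabilities can be read off a
polynomial-valued expectation. -/
theorem coeff_wordSum (p q : ℝ) (t n : ℕ) (f : Word → Polynomial ℝ) :
    (wordSum (Polynomial.C p) (Polynomial.C q) n f).coeff t =
      wordSum p q n fun x => (f x).coeff t := by
  induction n generalizing f with
  | zero => rfl
  | succ n ih => simp only [wordSum, Polynomial.coeff_add, Polynomial.coeff_C_mul, ih]

variable {Ω : Type*} [MeasurableSpace Ω] {P : Measure Ω}
  {X : ℕ → Ω → Fin 2} {p q : ℝ}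

theorem measureReal_prefix (hindep : iIndepFun X P)
    (hp : ∀ i, P.real {ω | X i ω = 0} = p) (hq : ∀ i, P.real {ω | X i ω = 1} = q)
    {n : ℕ} (v : Fin n → Fin 2) :
    P.real {ω | ∀ i : Fin n, X i ω = v i} = ∏ i, if v i = 0 then p else q := by
  have h1 := (hindep.precomp (Fin.val_injective (n := n))).meas_iInter
    (s := fun i : Fin n => {ω | X i ω = v i}) fun i => ⟨{v i}, measurableSet_singleton _, rfl⟩
  have h2 : {ω | ∀ i : Fin n, X i ω = v i} = ⋂ i : Fin n, {ω | X i ω = v i} := by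
    ext ω; simp
  rw [h2, Measure.real, h1, ENNReal.toReal_prod]
  refine Finset.prod_congr rfl fun i _ => ?_
  split_ifs with h
  · rw [h]; exact hp i
  · rw [show v i = 1 by omega]; exact hq i

variable [IsProbabilityMeasure P]

theorem measureReal_word (hmeas : ∀ i, Measurable (X i)) (hindep : iIndepFun X P)
    (hp : ∀ i, P.real {ω | X i ω = 0} = p) (hq : ∀ i, P.real {ω | X i ω = 1} = q)
    (n : ℕ) (S : Word → Prop) [DecidablePred S] :
    P.real {ω | S (pre n fun i => X i ω)} = wordSum p q n fun x => if S x then 1 else 0 := by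
  have h1 : {ω | S (pre n fun i => X i ω)} =
      ⋃ v ∈ (Finset.univ : Finset (Fin n → Fin 2)).filter (fun v => S (List.ofFn v)),
        {ω | ∀ i : Fin n, X i ω = v i} := by
    ext ω
    simp only [Set.mem_ofPred_eq, Finset.mem_filter, Finset.mem_univ, true_and, Set.mem_iUnion,
      exists_prop]
    constructor
    · exact fun h => ⟨_, h, fun _ => rfl⟩
    · rintro ⟨v, hv, h⟩
      rwa [pre, show (fun i : Fin n => X i ω) = v from funext h]
  rw [h1, measureReal_biUnion_finset, ← sum_prod_eq_wordSum, Finset.sum_filter]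
  · refine Finset.sum_congr rfl fun v _ => ?_
    rw [measureReal_prefix hindep hp hq]
    split_ifs <;> simp
  · intro v _ w _ hvw
    refine Set.disjoint_left.2 fun ω hv hw => hvw (funext fun i => ?_)
    exact (hv i).symm.trans (hw i)
  · intro v _
    have : {ω | ∀ i : Fin n, X i ω = v i} = ⋂ i : Fin n, X i ⁻¹' {v i} := by
      ext ω; simp
    rw [this]
    exact MeasurableSet.iInter fun i => hmeas i (measurableSet_singleton _)

theorem add_eq_one_of_law (hmeas : ∀ i, Measurable (X i))
    (hp : ∀ i, P.real {ω | X i ω = 0} = p) (hq : ∀ i, P.real {ω | X i ω = 1} = q) :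
    p + q = 1 := by
  have h1 : {ω | X 0 ω = 1} = {ω | X 0 ω = 0}ᶜ := by
    ext ω; simp only [Set.mem_ofPred_eq, Set.mem_compl_iff]; omega
  have h2 : MeasurableSet {ω | X 0 ω = 0} := hmeas 0 (measurableSet_singleton 0)
  rw [← hp 0, ← hq 0, h1, measureReal_add_measureReal_compl h2]
  simp

/-- Condition on the first letter: a 0 lengthens the open gap, a 1 closes it and contributes the
factor u ^ W l. -/
theorem wordSum_gapSum {R : Type*} [CommRing R] {p q : R} (hpq : p + q = 1) {h : ℕ}
    (m : Fin h → ℕ) (b : Fin h → R) (u : R) (W : ℕ → ℕ)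
    (hW : ∀ l, u ^ W l = 1 + ∑ i, if m i ≤ l then b i else 0) (n : ℕ) :
    q * wordSum p q n (fun x => u ^ gapSum W 0 x) =
      stepCoeff m (fun i => q * p ^ m i * b i) (n + 1) -
        p * stepCoeff m (fun i => q * p ^ m i * b i) n := by
  refine renewal_formula hpq m b (fun n l => wordSum p q n fun x => u ^ gapSum W l x) _ hW
    (fun l => rfl) (fun n l => ?_) n
  simp only [wordSum, gapSum, if_true, one_ne_zero, if_false, pow_add, wordSum_mul_left]
  ring

open Polynomial in
theorem measureReal_gapSum (hmeas : ∀ i, Measurable (X i)) (hindep : iIndepFun X P)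
    (hp : ∀ i, P.real {ω | X i ω = 0} = p) (hq : ∀ i, P.real {ω | X i ω = 1} = q) (hq0 : 0 < q)
    {h : ℕ} (m : Fin h → ℕ) (b : Fin h → ℝ[X]) (W : ℕ → ℕ)
    (hW : ∀ l, (Polynomial.X : ℝ[X]) ^ W l = 1 + ∑ i, if m i ≤ l then b i else 0) (n t : ℕ) :
    P.real {ω | gapSum W 0 (pre n fun i => X i ω) = t} =
      q⁻¹ * ((stepCoeff m (fun i => C q * C p ^ m i * b i) (n + 1)).coeff t -
        p * (stepCoeff m (fun i => C q * C p ^ m i * b i) n).coeff t) := by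
  have hpq : (C p : ℝ[X]) + C q = 1 := by
    rw [← C_add, add_eq_one_of_law hmeas hp hq, C_1]
  have h1 := congrArg (fun f => f.coeff t) (wordSum_gapSum hpq m b Polynomial.X W hW n)
  simp only [coeff_C_mul, coeff_sub, coeff_wordSum, coeff_X_pow] at h1
  rw [← h1, inv_mul_cancel_left₀ hq0.ne', measureReal_word hmeas hindep hp hq n
    (fun x => gapSum W 0 x = t)]
  simp only [eq_comm]

end Law

/-! ### Coefficients of u^t for the two kinds of weights. -/

section Coefficients

open Polynomial

theorem coeff_X_pow_mul_X_sub_one_pow (s K t : ℕ) :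
    ((X : ℝ[X]) ^ s * (X - 1) ^ K).coeff t =
      ∑ r ∈ (Finset.range (K + 1)).filter (fun r : ℕ => (t : ℤ) = ((s + K : ℕ) : ℤ) - (r : ℤ)),
        (-1 : ℝ) ^ r * (K.choose r : ℝ) := by
  have h1 : (X : ℝ[X]) ^ s * (X - 1) ^ K =
      ∑ r ∈ Finset.range (K + 1), C ((-1 : ℝ) ^ r * (K.choose r : ℝ)) * X ^ (s + (K - r)) := by
    rw [show (X - 1 : ℝ[X]) = -1 + X by ring, add_pow, Finset.mul_sum]
    refine Finset.sum_congr rfl fun r _ => ?_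
    rw [pow_add]
    simp only [map_mul, map_pow, map_neg, map_one, map_natCast]
    ring
  rw [h1, finsetSum_coeff, Finset.sum_filter]
  refine Finset.sum_congr rfl fun r hr => ?_
  rw [coeff_C_mul, coeff_X_pow, mul_ite, mul_one, mul_zero]
  refine if_congr ?_ rfl rfl
  have := Finset.mem_range.1 hr
  omega

theorem coeff_X_sub_one_pow (K t : ℕ) :
    ((X - 1 : ℝ[X]) ^ K).coeff t = (-1) ^ (K - t) * (K.choose t : ℝ) := by
  rw [show (X - 1 : ℝ[X]) = X + C (-1) by simp [sub_eq_add_neg], coeff_X_add_C_pow]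

theorem arrangements_sub {a h : ℕ} {m k : Fin h → ℕ} (hk : k ∈ tuples a m) :
    (arrangements (a - ∑ i, m i * k i) k : ℝ) = multinom (a - ∑ i, m i * k i) k := by
  rw [mem_tuples] at hk
  simp only [add_mul, one_mul, Finset.sum_add_distrib] at hk
  exact arrangements_eq_multinom (by omega)

theorem prod_stepWeight (p q : ℝ) {h : ℕ} (m k : Fin h → ℕ) (b : Fin h → ℝ[X]) :
    ∏ i, (C q * C p ^ m i * b i) ^ k i =
      C (q ^ (∑ i, k i) * p ^ (∑ i, m i * k i)) * ∏ i, b i ^ k i := by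
  simp only [mul_pow, Finset.prod_mul_distrib, ← pow_mul, Finset.prod_pow_eq_pow_sum, map_mul,
    map_pow]

theorem coeff_stepCoeff (p q : ℝ) {h : ℕ} (m : Fin h → ℕ) (b : Fin h → ℝ[X]) (a t : ℕ) :
    (stepCoeff m (fun i => C q * C p ^ m i * b i) a).coeff t =
      ∑ k ∈ tuples a m, multinom (a - ∑ i, m i * k i) k * q ^ (∑ i, k i) * p ^ (∑ i, m i * k i) *
        (∏ i, b i ^ k i).coeff t := by
  rw [stepCoeff, finsetSum_coeff]
  refine Finset.sum_congr rfl fun k hk => ?_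
  rw [prod_stepWeight, ← arrangements_sub hk, ← C_eq_natCast, coeff_C_mul, coeff_C_mul]
  ring

theorem coeff_prod_step {h : ℕ} (k : Fin h → ℕ) (t : ℕ) :
    (∏ i : Fin h, ((X : ℝ[X]) ^ (i : ℕ) * (X - 1)) ^ k i).coeff t =
      ∑ r ∈ (Finset.range (∑ i, k i + 1)).filter
          (fun r : ℕ => (t : ℤ) = (∑ i : Fin h, ((i : ℤ) + 1) * (k i : ℤ)) - (r : ℤ)),
        (-1 : ℝ) ^ r * ((∑ i, k i).choose r : ℝ) := by
  simp only [mul_pow, Finset.prod_mul_distrib, ← pow_mul, Finset.prod_pow_eq_pow_sum]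
  rw [coeff_X_pow_mul_X_sub_one_pow]
  have : ((∑ i : Fin h, (i : ℕ) * k i + ∑ i, k i : ℕ) : ℤ) =
      ∑ i : Fin h, ((i : ℤ) + 1) * (k i : ℤ) := by
    push_cast
    rw [← Finset.sum_add_distrib]
    exact Finset.sum_congr rfl fun i _ => by ring
  rw [this]

/-- Telescoping: the thresholds below l form an initial segment, and passing the one with zero-based
index i raises u^i to u^(i+1). -/
theorem X_pow_card_eq {h : ℕ} {m : Fin h → ℕ} (hm : StrictMono m) (l : ℕ) :
    (X : ℝ[X]) ^ (∑ i, if m i ≤ l then 1 else 0) =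
      1 + ∑ i : Fin h, if m i ≤ l then X ^ (i : ℕ) * (X - 1) else 0 := by
  induction h with
  | zero => simp
  | succ h ih =>
    have hm' : StrictMono fun i : Fin h => m i.castSucc := fun i j hij =>
      hm (Fin.castSucc_lt_castSucc_iff.2 hij)
    rw [Fin.sum_univ_castSucc, Fin.sum_univ_castSucc, pow_add, ih hm']
    by_cases hl : m (Fin.last h) ≤ l
    · have h1 : ∀ i : Fin h, m i.castSucc ≤ l := fun i =>
        (hm.monotone (Fin.le_last _)).trans hl
      have h2 := ih hm'
      simp only [h1, hl, if_true, Finset.sum_const, Finset.card_univ, Fintype.card_fin,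
        smul_eq_mul, mul_one, pow_one, Fin.val_castSucc, Fin.val_last] at h2 ⊢
      rw [← add_assoc, ← h2]
      ring
    · simp only [hl, if_false, pow_zero, mul_one, add_zero, Fin.val_castSucc]

/-- The increment u - 1 gained at threshold m is cancelled at m + 1. -/
theorem X_pow_exact_eq (m l : ℕ) :
    (X : ℝ[X]) ^ (if l = m then 1 else 0) =
      1 + ∑ i : Fin 2, if (![m, m + 1] : Fin 2 → ℕ) i ≤ l then
        (![X - 1, -(X - 1)] : Fin 2 → ℝ[X]) i else 0 := by
  rw [Fin.sum_univ_two]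
  rcases lt_trichotomy l m with h | h | h
  · simp [h.ne, show ¬ m ≤ l by omega, show ¬ m + 1 ≤ l by omega]
  · simp [h]
  · simp [h.ne', h.le, show m + 1 ≤ l by omega]

theorem coeff_prod_exact (k : Fin 2 → ℕ) (t : ℕ) :
    (∏ i, (![X - 1, -(X - 1)] : Fin 2 → ℝ[X]) i ^ k i).coeff t =
      (-1) ^ ((k 0 : ℤ) - (t : ℤ)) * ((k 0 + k 1).choose t : ℝ) := by
  rw [Fin.prod_univ_two]
  simp only [Matrix.cons_val_zero, Matrix.cons_val_one]
  have h1 : (X - 1 : ℝ[X]) ^ k 0 * (-(X - 1)) ^ k 1 = C ((-1) ^ k 1) * (X - 1) ^ (k 0 + k 1) := by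
    rw [neg_pow, pow_add, map_pow, map_neg, map_one]; ring
  rw [h1, coeff_C_mul]
  by_cases ht : t ≤ k 0 + k 1
  · rw [coeff_X_sub_one_pow, ← mul_assoc, ← pow_add]
    congr 1
    -- The exponent k 0 - t may be negative; it differs from the natural one by the even number 2 *
    -- k 1.
    rw [← zpow_natCast, show ((k 1 + (k 0 + k 1 - t) : ℕ) : ℤ) = (k 0 - t : ℤ) + 2 * (k 1 : ℤ) by
      omega, zpow_add₀ (by norm_num), zpow_mul]
    norm_num
  · rw [Nat.choose_eq_zero_of_lt (by omega), Nat.cast_zero, mul_zero, coeff_eq_zero_of_natDegree_lt,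
      mul_zero]
    refine lt_of_le_of_lt natDegree_pow_le ?_
    rw [← C_1, natDegree_X_sub_C]
    omega

end Coefficients

/-! ### Closed forms for one threshold and for two consecutive ones. -/

section ClosedForms

open Polynomial

theorem multinom_fin_one (a : ℕ) (k : Fin 1 → ℕ) :
    multinom a k = (a ! : ℝ) / ((k 0)! * (a - k 0)!) := by
  simp [multinom]

theorem multinom_pair (a k l : ℕ) :
    multinom a ![k, l] = (a ! : ℝ) / ((k ! * l !) * (a - (k + l))!) := by
  simp [multinom, Fin.prod_univ_two, Fin.sum_univ_two]

theorem multinom_mul_choose (a : ℕ) (k : Fin 1 → ℕ) {t : ℕ} (ht : t ≤ k 0) :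
    multinom a k * ((k 0).choose t : ℝ) = multinom a ![t, k 0 - t] := by
  rw [multinom_fin_one, multinom_pair, Nat.cast_choose ℝ ht, Nat.add_sub_cancel' ht]
  have h1 : ((k 0)! : ℝ) ≠ 0 := by exact_mod_cast Nat.factorial_ne_zero _
  field_simp

theorem multinom_zero_left {a k : ℕ} (hk : k ≤ a) : multinom a ![0, k] = (a.choose k : ℝ) := by
  rw [multinom_pair, Nat.cast_choose ℝ hk]
  simp

theorem coeff_stepCoeff_single (p q : ℝ) (m a t : ℕ) :
    (stepCoeff ![m] (fun i => C q * C p ^ (![m] : Fin 1 → ℕ) i *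
        (X ^ (i : ℕ) * (X - 1))) a).coeff t =
      ∑ k ∈ Finset.Icc t (a / (m + 1)),
        (-1 : ℝ) ^ (k - t) * multinom (a - m * k) ![t, k - t] * q ^ k * p ^ (k * m) := by
  rw [coeff_stepCoeff]
  have hmem : ∀ k : Fin 1 → ℕ, k ∈ tuples a ![m] ↔ k 0 ≤ a / (m + 1) := by
    intro k
    rw [mem_tuples, Nat.le_div_iff_mul_le (Nat.succ_pos m), mul_comm (k 0)]
    simp
  -- Terms with k 0 < t vanish, as (u - 1) ^ k 0 has too small a degree.
  rw [← Finset.sum_filter_of_ne (p := fun k : Fin 1 → ℕ => t ≤ k 0)]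
  · refine Finset.sum_nbij' (fun k => k 0) (fun k _ => k) ?_ ?_ ?_ ?_ ?_
    · intro k hk
      rw [Finset.mem_filter, hmem] at hk
      exact Finset.mem_Icc.2 ⟨hk.2, hk.1⟩
    · intro k hk
      rw [Finset.mem_filter, hmem]
      exact (Finset.mem_Icc.1 hk).symm
    · intro k _
      funext i
      rw [Subsingleton.elim i 0]
    · intro k _
      rfl
    · intro k hk
      rw [← multinom_mul_choose _ k (Finset.mem_filter.1 hk).2]
      simp only [Fin.prod_univ_one, Fin.sum_univ_one, Fin.val_zero, pow_zero, one_mul,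
        coeff_X_sub_one_pow, Matrix.cons_val_fin_one]
      rw [mul_comm (k 0) m]
      ring
  · intro k _ hne
    by_contra ht
    refine hne ?_
    rw [Fin.prod_univ_one, Fin.val_zero, pow_zero, one_mul, coeff_X_sub_one_pow,
      Nat.choose_eq_zero_of_lt (not_le.1 ht)]
    simp

theorem coeff_stepCoeff_exact (p q : ℝ) (m a t : ℕ) :
    (stepCoeff ![m, m + 1] (fun i => C q * C p ^ (![m, m + 1] : Fin 2 → ℕ) i *
        (![X - 1, -(X - 1)] : Fin 2 → ℝ[X]) i) a).coeff t =
      ∑ k ∈ pairs a m t, (-1 : ℝ) ^ ((k.1 : ℤ) - (t : ℤ)) *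
        multinom (a - (m * k.1 + (m + 1) * k.2)) ![k.1, k.2] * ((k.1 + k.2).choose t : ℝ) *
        q ^ (k.1 + k.2) * p ^ (k.1 * m + k.2 * (m + 1)) := by
  rw [coeff_stepCoeff]
  simp only [coeff_prod_exact]
  have hmem : ∀ k : Fin 2 → ℕ, k ∈ tuples a ![m, m + 1] ↔
      (m + 1) * k 0 + (m + 2) * k 1 ≤ a := by
    intro k
    rw [mem_tuples, Fin.sum_univ_two]
    rfl
  rw [← Finset.sum_filter_of_ne (p := fun k : Fin 2 → ℕ => t ≤ k 0 + k 1)]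
  · refine Finset.sum_nbij' (fun k => (k 0, k 1)) (fun k => ![k.1, k.2]) ?_ ?_ ?_ ?_ ?_
    · intro k hk
      rw [Finset.mem_filter, hmem] at hk
      exact mem_pairs.2 hk
    · intro k hk
      rw [Finset.mem_filter, hmem]
      exact mem_pairs.1 hk
    · intro k _
      funext i
      fin_cases i <;> rfl
    · intro k _
      rfl
    · intro k _
      have hk : ![k 0, k 1] = k := by
        funext i
        fin_cases i <;> rfl
      simp only [Fin.sum_univ_two, Matrix.cons_val_zero, Matrix.cons_val_one, hk]
      rw [mul_comm (k 0) m, mul_comm (k 1) (m + 1)]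
      ring
  · intro k _ hne
    by_contra ht
    refine hne ?_
    rw [Nat.choose_eq_zero_of_lt (not_le.1 ht)]
    simp

end ClosedForms

/-! ### Laws of the statistics. -/

section Laws

variable {Ω : Type*} [MeasurableSpace Ω] {P : Measure Ω} [IsProbabilityMeasure P]
  {X : ℕ → Ω → Fin 2} {p q : ℝ}

theorem measureReal_D (hmeas : ∀ i, Measurable (X i)) (hindep : iIndepFun X P)
    (hp : ∀ i, P.real {ω | X i ω = 0} = p) (hq : ∀ i, P.real {ω | X i ω = 1} = q) (hq0 : 0 < q)
    {h : ℕ} {m : Fin h → ℕ} (hm : StrictMono m) (n t : ℕ) :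
    P.real {ω | ZeroRuns.D m (pre n fun i => X i ω) = (t : ℤ)} =
      q⁻¹ * ((stepCoeff m (fun i => Polynomial.C q * Polynomial.C p ^ m i *
          (Polynomial.X ^ (i : ℕ) * (Polynomial.X - 1))) (n + 1)).coeff t -
        p * (stepCoeff m (fun i => Polynomial.C q * Polynomial.C p ^ m i *
          (Polynomial.X ^ (i : ℕ) * (Polynomial.X - 1))) n).coeff t) := by
  rw [← measureReal_gapSum hmeas hindep hp hq hq0 m _ _ (X_pow_card_eq hm) n t]
  simp only [D_eq_gapSum, Nat.cast_inj]

theorem measureReal_D_single (hmeas : ∀ i, Measurable (X i)) (hindep : iIndepFun X P)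
    (hp : ∀ i, P.real {ω | X i ω = 0} = p) (hq : ∀ i, P.real {ω | X i ω = 1} = q) (hq0 : 0 < q)
    (m n t : ℕ) :
    P.real {ω | ZeroRuns.D ![m] (pre n fun i => X i ω) = (t : ℤ)} =
      (∑ k ∈ Finset.Icc t ((n + 1) / (m + 1)),
        (-1 : ℝ) ^ (k - t) * multinom (n + 1 - m * k) ![t, k - t] *
          q ^ ((k : ℤ) - 1) * p ^ (k * m)) -
      ∑ k ∈ Finset.Icc t (n / (m + 1)),
        (-1 : ℝ) ^ (k - t) * multinom (n - m * k) ![t, k - t] *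
          q ^ ((k : ℤ) - 1) * p ^ (k * m + 1) := by
  rw [measureReal_D hmeas hindep hp hq hq0 (Subsingleton.strictMono _), coeff_stepCoeff_single,
    coeff_stepCoeff_single, mul_sub, Finset.mul_sum, Finset.mul_sum, Finset.mul_sum]
  -- The factor q⁻¹ removes the weight of the 1 put in front; for k = 0 the exponent is -1, hence
  -- integer powers.
  simp only [zpow_sub_one₀ hq0.ne', zpow_natCast]
  congr 1 <;> exact Finset.sum_congr rfl fun k _ => by ring

theorem D_singleton (m : ℕ) (x : Word) :
    D ![m] x = (gapSum (fun l => if m ≤ l then 1 else 0) 0 x : ℕ) := by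
  rw [D_eq_gapSum]
  simp

theorem L_lt_iff_D_eq_zero {m : ℕ} (hm : 1 ≤ m) (x : Word) : L x < m ↔ D ![m] x = 0 := by
  rw [L_lt_iff, zeros_infix_iff hm, not_not, D_singleton, Nat.cast_eq_zero]

end Laws

end ZeroRuns

theorem theorem4 {Ω : Type*} [MeasurableSpace Ω] (P : Measure Ω) [IsProbabilityMeasure P]
    (X : ℕ → Ω → Fin 2) (hmeas : ∀ i, Measurable (X i)) (hindep : iIndepFun X P)
    (p q : ℝ) (hp : ∀ i, P.real {ω | X i ω = 0} = p) (hq : ∀ i, P.real {ω | X i ω = 1} = q)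
    (hq0 : 0 < q) (n : ℕ) :
    -- 1. the law of `D`
    (∀ (h : ℕ) (m : Fin h → ℕ), StrictMono m → ∀ t : ℕ,
      P.real {ω | ZeroRuns.D m (pre n fun i => X i ω) = (t : ℤ)} =
        (∑ k ∈ tuples (n + 1) m,
          ∑ r ∈ (Finset.range (∑ i, k i + 1)).filter
              (fun r : ℕ => (t : ℤ) = (∑ i : Fin h, ((i : ℤ) + 1) * (k i : ℤ)) - (r : ℤ)),
            (-1 : ℝ) ^ r * multinom (n + 1 - ∑ i, m i * k i) k *
              ((∑ i, k i).choose r : ℝ) * q ^ (((∑ i, k i : ℕ) : ℤ) - 1) *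
              p ^ (∑ i, m i * k i)) -
        ∑ k ∈ tuples n m,
          ∑ r ∈ (Finset.range (∑ i, k i + 1)).filter
              (fun r : ℕ => (t : ℤ) = (∑ i : Fin h, ((i : ℤ) + 1) * (k i : ℤ)) - (r : ℤ)),
            (-1 : ℝ) ^ r * multinom (n - ∑ i, m i * k i) k *
              ((∑ i, k i).choose r : ℝ) * q ^ (((∑ i, k i : ℕ) : ℤ) - 1) *
              p ^ (1 + ∑ i, m i * k i)) ∧
    -- 2. the law of the `μ`-overlapping count
    (∀ m μ : ℕ, μ < m → ∀ t : ℕ,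
      P.real {ω | ZeroRuns.N m μ (pre n fun i => X i ω) = t} =
        P.real {ω | ZeroRuns.D (fun i : Fin ((n - μ) / (m - μ)) => m * ((i : ℕ) + 1) - μ * (i : ℕ))
          (pre n fun i => X i ω) = (t : ℤ)}) ∧
    -- 3. the law of the number of runs of length at least `m`
    (∀ m : ℕ, 1 ≤ m → ∀ t : ℕ,
      P.real {ω | ZeroRuns.G m (pre n fun i => X i ω) = t} =
        P.real {ω | ZeroRuns.D ![m] (pre n fun i => X i ω) = (t : ℤ)} ∧
      P.real {ω | ZeroRuns.D ![m] (pre n fun i => X i ω) = (t : ℤ)} =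
        (∑ k ∈ Finset.Icc t ((n + 1) / (m + 1)),
          (-1 : ℝ) ^ (k - t) * multinom (n + 1 - m * k) ![t, k - t] *
            q ^ ((k : ℤ) - 1) * p ^ (k * m)) -
        ∑ k ∈ Finset.Icc t (n / (m + 1)),
          (-1 : ℝ) ^ (k - t) * multinom (n - m * k) ![t, k - t] *
            q ^ ((k : ℤ) - 1) * p ^ (k * m + 1)) ∧
    -- 4. the waiting time and the longest run
    (∀ m : ℕ, 1 ≤ m →
      P.real {ω | (n : ℕ∞) < ZeroRuns.T m fun i => X i ω} =
        P.real {ω | ZeroRuns.L (pre n fun i => X i ω) < m} ∧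
      P.real {ω | ZeroRuns.L (pre n fun i => X i ω) < m} =
        P.real {ω | ZeroRuns.D ![m] (pre n fun i => X i ω) = 0} ∧
      P.real {ω | ZeroRuns.D ![m] (pre n fun i => X i ω) = 0} =
        (∑ k ∈ Finset.Icc 0 ((n + 1) / (m + 1)),
          (-1 : ℝ) ^ k * ((n + 1 - m * k).choose k : ℝ) * q ^ ((k : ℤ) - 1) * p ^ (k * m)) -
        ∑ k ∈ Finset.Icc 0 (n / (m + 1)),
          (-1 : ℝ) ^ k * ((n - m * k).choose k : ℝ) * q ^ ((k : ℤ) - 1) * p ^ (k * m + 1)) ∧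
    -- 5. the law of the number of runs of length exactly `m`
    (∀ m : ℕ, 1 ≤ m → ∀ t : ℕ,
      P.real {ω | ZeroRuns.E m (pre n fun i => X i ω) = t} =
        (∑ k ∈ pairs (n + 1) m t,
          (-1 : ℝ) ^ ((k.1 : ℤ) - (t : ℤ)) *
            multinom (n + 1 - (m * k.1 + (m + 1) * k.2)) ![k.1, k.2] *
            ((k.1 + k.2).choose t : ℝ) * q ^ ((k.1 : ℤ) + (k.2 : ℤ) - 1) *
            p ^ (k.1 * m + k.2 * (m + 1))) -
        ∑ k ∈ pairs n m t,
          (-1 : ℝ) ^ ((k.1 : ℤ) - (t : ℤ)) *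
            multinom (n - (m * k.1 + (m + 1) * k.2)) ![k.1, k.2] *
            ((k.1 + k.2).choose t : ℝ) * q ^ ((k.1 : ℤ) + (k.2 : ℤ) - 1) *
            p ^ (k.1 * m + k.2 * (m + 1) + 1)) := by
  refine ⟨fun h m hm t => ?_, fun m μ hμ t => ?_, fun m hm t => ⟨?_, ?_⟩,
    fun m hm => ⟨?_, ?_, ?_⟩, fun m hm t => ?_⟩
  · rw [measureReal_D hmeas hindep hp hq hq0 hm, coeff_stepCoeff, coeff_stepCoeff, mul_sub,
      Finset.mul_sum, Finset.mul_sum, Finset.mul_sum]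
    simp only [coeff_prod_step, zpow_sub_one₀ hq0.ne', zpow_natCast, Finset.mul_sum]
    congr 1 <;>
      exact Finset.sum_congr rfl fun k _ => Finset.sum_congr rfl fun r _ => by ring
  · congr 1
    ext ω
    have h1 := N_eq_D hμ (pre n fun i => X i ω)
    rw [show (pre n fun i => X i ω).length = n by simp [pre]] at h1
    rw [Set.mem_ofPred_eq, Set.mem_ofPred_eq, ← h1, Nat.cast_inj]
  · simp only [D_singleton, G_eq_gapSum hm, Nat.cast_inj]
  · exact measureReal_D_single hmeas hindep hp hq hq0 m n t
  · simp only [lt_T_iff, L_lt_iff]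
  · simp only [L_lt_iff_D_eq_zero hm]
  · have h1 := measureReal_D_single hmeas hindep hp hq hq0 m n 0
    rw [Nat.cast_zero] at h1
    rw [h1]
    -- From (m + 1) k ≤ a; the multinomial is a binomial only when its truncated subtraction is
    -- genuine.
    have h2 : ∀ a k, k ∈ Finset.Icc 0 (a / (m + 1)) → k ≤ a - m * k := by
      intro a k hk
      have h3 := (Nat.le_div_iff_mul_le (Nat.succ_pos m)).1 (Finset.mem_Icc.1 hk).2
      rw [Nat.succ_eq_add_one, mul_add, mul_one, mul_comm] at h3
      omega
    congr 1 <;>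
      exact Finset.sum_congr rfl fun k hk => by rw [Nat.sub_zero, multinom_zero_left (h2 _ _ hk)]
  · simp only [E_eq_gapSum hm]
    rw [measureReal_gapSum hmeas hindep hp hq hq0 _ _ _ (X_pow_exact_eq m), coeff_stepCoeff_exact,
      coeff_stepCoeff_exact, mul_sub, Finset.mul_sum, Finset.mul_sum, Finset.mul_sum]
    simp only [zpow_sub_one₀ hq0.ne', zpow_natCast, ← Nat.cast_add]
    congr 1 <;> exact Finset.sum_congr rfl fun k _ => by ring
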